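/- All varieties are complex. A subvariety of $\mathbb{P}^n$ is a reduced closed subscheme (not necessarily irreducible), "point" means closed point, $I_X \subseteq \mathbb{C}[x_0,\dots,x_n]$ is the saturated homogeneous ideal of $X$, and $X$ is non-degenerate if it is not contained in a hyperplane. For a finite set $\Gamma$ of points, $\pi_\Gamma$ denotes the linear projection of $\mathbb{P}^n$ away from the linear span of $\Gamma$, and $\pi_\Gamma(X)$ is the (closed) image of $X$ under this rational map. The quadratic persistence $\operatorname{qp}(X)$ is the smallest $k \in \mathbb{N}$ for which there is a set $\Gamma$ of $k$ points of $X$ such that $I_{\pi_\Gamma(X)}$ contains no nonzero quadratic form. For $X \subseteq X' \subseteq \mathbb{P}^n$ the quadratic residual is $\operatorname{qr}(X,X') := \dim_{\mathbb{C}} (I_X)_2 - \dim_{\mathbb{C}} (I_{X'})_2$. A subvariety $X' \subseteq \mathbb{P}^n$ is a cone with vertex $q \in X'$ if there is a proper subvariety $Y \subset X'$ with $q \notin Y$ such that $X'$ is the union of the lines joining $q$ to the points of $Y$. If $X'$ is irreducible, a subvariety $X \subseteq X'$ is transverse to general inner projections if, for all $0 \le k \le \dim X'$ and all sets $\Gamma'$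 of $k$ general points of $X'$, there is a set $\Gamma$ of $k$ general points of $X$ such that $\pi_\Gamma(X')$ is projectively equivalent to $\pi_{\Gamma'}(X')$. (Explicitly: for every dense Zariski-open $U \subseteq X^k$ there is a dense Zariski-open $U' \subseteq X'^k$ such that each $\Gamma' \in U'$ admits such a $\Gamma \in U$.) Theorem. Let $X \subset \mathbb{P}^n$ be a non-degenerate irreducible subvariety, and let $X' \subseteq \mathbb{P}^n$ be a cone containing $X$ such that $\dim X' = 1 + \dim X$ and, for some vertex $q \in X'$, $\pi_{\{q\}}(X') = \pi_{\{q\}}(X)$. If $X \subset X'$ is transverse to general inner projections, then $$\operatorname{qp}(X) \le \max\{\operatorname{qp}(X'), \operatorname{qr}(X,X')\}.$$ -/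

import Mathlib

open scoped LinearAlgebra.Projectivization

noncomputable section

namespace QuadPers

/-- The (closed points of the) complex projective space with `m` homogeneous coordinates, so that
`PP (n + 1)` is `ℙⁿ` and `PP 0` is empty. -/
abbrev PP (m : ℕ) : Type := ℙ ℂ (Fin m → ℂ)

/-- The Zariski topology on projective space: generated by the non-vanishing loci of homogeneous
polynomials (these form a basis, so the closed sets are the projective zero loci). -/
instance zariski (m : ℕ) : TopologicalSpace (PP m) :=
  TopologicalSpace.generateFrom
    {U | ∃ (d : ℕ) (F : MvPolynomial (Fin m) ℂ), F.IsHomogeneous d ∧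
      U = {p : PP m | MvPolynomial.eval p.rep F ≠ 0}}

/-- The Zariski topology on the `k`-fold product of projective space with itself (it is finer than
the product of the Zariski topologies): generated by the non-vanishing loci of multihomogeneous
polynomials in `k` groups of `m` variables. -/
@[reducible] def multiZariski (k m : ℕ) : TopologicalSpace (Fin k → PP m) :=
  TopologicalSpace.generateFrom
    {U | ∃ (d : Fin k → ℕ) (F : MvPolynomial (Fin k × Fin m) ℂ),
      F.IsWeightedHomogeneous (fun ij => (Pi.single ij.1 1 : Fin k → ℕ)) d ∧
      U = {p : Fin k → PP m | MvPolynomial.eval (fun ij => (p ij.1).rep ij.2) F ≠ 0}}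

/-- The `k`-fold self-product `X × ⋯ × X`. -/
def power {m : ℕ} (k : ℕ) (X : Set (PP m)) : Set (Fin k → PP m) := {p | ∀ i, p i ∈ X}

/-- `U` is a dense Zariski-open subset of `X × ⋯ × X` (`k` factors). -/
def IsDenseOpenIn {m k : ℕ} (U : Set (Fin k → PP m)) (X : Set (PP m)) : Prop :=
  (∃ O : Set (Fin k → PP m), @IsOpen _ (multiZariski k m) O ∧ U = O ∩ power k X) ∧
    power k X ⊆ @closure _ (multiZariski k m) U

/-- The dimension of a subvariety. -/
def dim {m : ℕ} (X : Set (PP m)) : WithBot ℕ∞ := topologicalKrullDim X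

/-- Not contained in a hyperplane. -/
def NonDegenerate {m : ℕ} (X : Set (PP m)) : Prop :=
  ∀ ℓ : (Fin m → ℂ) →ₗ[ℂ] ℂ, ℓ ≠ 0 → ∃ p ∈ X, ℓ p.rep ≠ 0

/-- The saturated homogeneous ideal `I_X`: the polynomials that vanish at every affine
representative of every point of `X`. -/
def idealOf {m : ℕ} (X : Set (PP m)) : Ideal (MvPolynomial (Fin m) ℂ) :=
  MvPolynomial.vanishingIdeal ℂ
    {v : Fin m → ℂ | ∃ hv : v ≠ 0, Projectivization.mk ℂ v hv ∈ X}

/-- The degree-two part `(I_X)₂` of the homogeneous ideal. -/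
def quadrics {m : ℕ} (X : Set (PP m)) : Submodule ℂ (MvPolynomial (Fin m) ℂ) :=
  (idealOf X).restrictScalars ℂ ⊓ MvPolynomial.homogeneousSubmodule (Fin m) ℂ 2

/-- The linear span of a set of points, as a linear subspace of the affine space `ℂᵐ`. -/
def linSpan {m : ℕ} (Γ : Set (PP m)) : Submodule ℂ (Fin m → ℂ) := ⨆ p ∈ Γ, p.submodule

/-- The number of homogeneous coordinates on the target of the projection away from `Γ`. -/
abbrev targetDim {m : ℕ} (Γ : Set (PP m)) : ℕ := Module.finrank ℂ ((Fin m → ℂ) ⧸ linSpan Γ)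

/-- The linear map underlying the linear projection away from `Γ`. The quotient by the span stands
for a complementary linear subspace; linear coordinates on it are fixed by a choice of basis (other
choices differ by a projective equivalence). -/
def projMap {m : ℕ} (Γ : Set (PP m)) : (Fin m → ℂ) →ₗ[ℂ] (Fin (targetDim Γ) → ℂ) :=
  (Module.finBasis ℂ ((Fin m → ℂ) ⧸ linSpan Γ)).equivFun.toLinearMap ∘ₗ (linSpan Γ).mkQ

/-- The image `π_Γ(X)` of `X` under the rational map `π_Γ`: the Zariski closure of the set of
images of the points of `X` outside the span of `Γ`. -/
def projImage {m : ℕ} (Γ X : Set (PP m)) : Set (PP (targetDim Γ)) :=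
  closure {y | ∃ p ∈ X, ∃ h : projMap Γ p.rep ≠ 0, y = Projectivization.mk ℂ (projMap Γ p.rep) h}

/-- Projective equivalence: a linear isomorphism of the ambient projective spaces carries one
set onto the other. -/
def ProjEquivalent {m m' : ℕ} (Y : Set (PP m)) (Y' : Set (PP m')) : Prop :=
  ∃ e : (Fin m → ℂ) ≃ₗ[ℂ] (Fin m' → ℂ),
    Projectivization.map e.toLinearMap e.injective '' Y = Y'

/-- Quadratic persistence: the least `k` such that, for some set `Γ` of `k` points of `X`, the
ideal of `π_Γ(X)` contains no (non-zero) quadratic form. Such `k` exist for non-degenerate `X`. -/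
def qp {m : ℕ} (X : Set (PP m)) : ℕ :=
  sInf {k | ∃ Γ : Finset (PP m), (Γ : Set (PP m)) ⊆ X ∧ Γ.card = k ∧
    quadrics (projImage (Γ : Set (PP m)) X) = ⊥}

/-- Quadratic residual `dim (I_X)₂ - dim (I_{X'})₂`. -/
def qr {m : ℕ} (X X' : Set (PP m)) : ℤ :=
  (Module.finrank ℂ (quadrics X) : ℤ) - (Module.finrank ℂ (quadrics X') : ℤ)

/-- `X'` is a cone with vertex `q`: the point `q` lies on `X'` and `X'` is the union of the lines
joining `q` to the points of a proper subvariety `Y` of `X'` that does not contain `q`. -/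
def IsConeWithVertex {m : ℕ} (X' : Set (PP m)) (q : PP m) : Prop :=
  q ∈ X' ∧ ∃ Y : Set (PP m), IsClosed Y ∧ Y ⊂ X' ∧ q ∉ Y ∧
    X' = ⋃ p ∈ Y, {x : PP m | x.submodule ≤ linSpan {q, p}}

/-- The subvariety `X` of the irreducible variety `X'` is transverse to general inner projections:
for `0 ≤ k ≤ dim X'` and `k` general points `Γ'` of `X'` there are `k` general points `Γ` of `X`
with `π_Γ(X')` projectively equivalent to `π_Γ'(X')`. As `Γ` depends on `Γ'`, this means: for each
dense open condition `U` on `Γ`, all `Γ'` in some dense open `U'` admit such a `Γ` in `U`. -/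
def TransverseToGeneralInnerProjections {m : ℕ} (X X' : Set (PP m)) : Prop :=
  IsIrreducible X' ∧ X ⊆ X' ∧
    ∀ k : ℕ, (k : WithBot ℕ∞) ≤ dim X' →
      ∀ U : Set (Fin k → PP m), IsDenseOpenIn U X →
        ∃ U' : Set (Fin k → PP m), IsDenseOpenIn U' X' ∧
          ∀ Γ' ∈ U', ∃ Γ ∈ U,
            ProjEquivalent (projImage (Set.range Γ) X') (projImage (Set.range Γ') X')

end QuadPers

end

namespace QuadPers

open MvPolynomial

/-! Quadrics through `π_Γ(X)` correspond to quadrics through `X` that are singular along the span of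
`Γ`, that is, invariant under translation by it. So it suffices to find few points of `X` whose span
`L` leaves no such quadric.

Take `max (qp X') (qr X X')` points of `X'` along whose span no nonzero quadric of `X'` is singular,
and exchange them one by one for points of `X`. Two conditions persist: no nonzero quadric of `X'`
is singular along the chosen and remaining points together, and the residual among quadrics singular
along the chosen points is at most the number of remaining points. When none remain, both spaces of
quadrics vanish.

An exchange asks a point of `X` to avoid two hypersurfaces. The first is a determinant
(`exists_form_of_inf_invariants_eq_bot`); as quadrics of `X'` are singular at the vertex `q`, it is
invariant along `q`, so it cannot vanish on all of `X` without vanishing on `X'`, which has the same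
projection from `q`. The second is the polar hyperplane at `q` of a quadric through `X` but not
`X'`; off it the residual drops (`finrank_add_lt_of_polar_ne_zero`). Irreducibility of `X` lets one
point avoid both. -/

/-- The polynomials that are invariant under translation by the vectors of `L`. -/
def invariants {m : ℕ} (L : Submodule ℂ (Fin m → ℂ)) : Submodule ℂ (MvPolynomial (Fin m) ℂ) where
  carrier := {F | ∀ l ∈ L, ∀ v, eval (v + l) F = eval v F}
  add_mem' hF hG l hl v := by simp [hF l hl v, hG l hl v]
  zero_mem' l _ v := by simp
  smul_mem' c F hF l hl v := by simp [hF l hl v]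

theorem mem_invariants {m : ℕ} {L : Submodule ℂ (Fin m → ℂ)} {F : MvPolynomial (Fin m) ℂ} :
    F ∈ invariants L ↔ ∀ l ∈ L, ∀ v, eval (v + l) F = eval v F := Iff.rfl

theorem invariants_anti {m : ℕ} {L M : Submodule ℂ (Fin m → ℂ)} (h : L ≤ M) :
    invariants M ≤ invariants L := fun _ hF l hl v => hF l (h hl) v

theorem invariants_sup {m : ℕ} (L M : Submodule ℂ (Fin m → ℂ)) :
    invariants (L ⊔ M) = invariants L ⊓ invariants M := by
  apply le_antisymm
  · exact le_inf (invariants_anti le_sup_left) (invariants_anti le_sup_right)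
  · rintro F ⟨h1, h2⟩ l hl v
    obtain ⟨a, ha, b, hb, rfl⟩ := Submodule.mem_sup.1 hl
    rw [← add_assoc, h2 b hb, h1 a ha]

theorem mem_quadrics {m : ℕ} {X : Set (PP m)} {F : MvPolynomial (Fin m) ℂ} :
    F ∈ quadrics X ↔ (∀ (v : Fin m → ℂ) (hv : v ≠ 0), Projectivization.mk ℂ v hv ∈ X →
      eval v F = 0) ∧ F.IsHomogeneous 2 := by
  simp only [quadrics, idealOf, Submodule.mem_inf, Submodule.restrictScalars_mem,
    mem_vanishingIdeal_iff, mem_homogeneousSubmodule]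
  refine and_congr_left fun _ => ⟨fun h v hv hX => ?_, fun h v hv => ?_⟩
  · simpa [aeval_eq_eval] using h v ⟨hv, hX⟩
  · simpa [aeval_eq_eval] using h v hv.1 hv.2

theorem quadrics_anti {m : ℕ} {X X' : Set (PP m)} (h : X ⊆ X') : quadrics X' ≤ quadrics X := by
  intro F hF
  rw [mem_quadrics] at hF ⊢
  exact ⟨fun v hv hX => hF.1 v hv (h hX), hF.2⟩

theorem finite_quadrics {m : ℕ} (X : Set (PP m)) : Module.Finite ℂ (quadrics X) := by
  have : Module.Finite ℂ (homogeneousSubmodule (Fin m) ℂ 2) :=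
    Module.Finite.iff_fg.2 (homogeneousSubmodule_fg _ _ 2)
  exact Submodule.finiteDimensional_of_le inf_le_right

theorem eval_smul_of_isHomogeneous {m d : ℕ} {F : MvPolynomial (Fin m) ℂ} (hF : F.IsHomogeneous d)
    (c : ℂ) (v : Fin m → ℂ) : eval (c • v) F = c ^ d * eval v F := by
  rw [eval_eq, eval_eq, Finset.mul_sum]
  refine Finset.sum_congr rfl fun e he => ?_
  have : ∏ i ∈ e.support, c ^ e i = c ^ d := by
    rw [Finset.prod_pow_eq_pow_sum, hF.degree_eq_sum_deg_support he]
  simp only [Pi.smul_apply, smul_eq_mul, mul_pow, Finset.prod_mul_distrib, this]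
  ring

theorem eval_rep_mk_eq_zero_iff {m d : ℕ} {F : MvPolynomial (Fin m) ℂ} (hF : F.IsHomogeneous d)
    (v : Fin m → ℂ) (hv : v ≠ 0) : eval (Projectivization.mk ℂ v hv).rep F = 0 ↔ eval v F = 0 := by
  obtain ⟨a, ha⟩ := Projectivization.exists_smul_eq_mk_rep ℂ v hv
  rw [← ha, Units.smul_def, eval_smul_of_isHomogeneous hF]
  simp

theorem mem_quadrics_iff_rep {m : ℕ} {X : Set (PP m)} {F : MvPolynomial (Fin m) ℂ} :
    F ∈ quadrics X ↔ (∀ p ∈ X, eval p.rep F = 0) ∧ F.IsHomogeneous 2 := by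
  rw [mem_quadrics]
  refine and_congr_left fun hF => ⟨fun h p hp => ?_, fun h v hv hX => ?_⟩
  · exact h _ p.rep_nonzero (by rwa [Projectivization.mk_rep])
  · exact (eval_rep_mk_eq_zero_iff hF v hv).1 (h _ hX)

theorem isOpen_eval_ne_zero {m d : ℕ} {F : MvPolynomial (Fin m) ℂ} (hF : F.IsHomogeneous d) :
    IsOpen {p : PP m | eval p.rep F ≠ 0} :=
  TopologicalSpace.isOpen_generateFrom_of_mem ⟨d, F, hF, rfl⟩

/-- Composition of a polynomial with a linear map. -/
theorem exists_comp_linearMap {m t d : ℕ} (f : (Fin t → ℂ) →ₗ[ℂ] (Fin m → ℂ))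
    {F : MvPolynomial (Fin m) ℂ} (hF : F.IsHomogeneous d) :
    ∃ H : MvPolynomial (Fin t) ℂ, H.IsHomogeneous d ∧ ∀ v, eval v H = eval (f v) F := by
  refine ⟨aeval ((LinearMap.toMatrix' f).toMvPolynomial) F, ?_, fun v => ?_⟩
  · simpa only [one_mul] using hF.aeval _ (fun i => Matrix.toMvPolynomial_isHomogeneous _ i)
  · rw [← aeval_eq_eval, ← AlgHom.comp_apply, comp_aeval, aeval_eq_eval]
    congr 2
    ext i
    simp [aeval_eq_eval, Matrix.toMvPolynomial_eval_eq_apply]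

/-! ### Projections and invariant forms -/

theorem projMap_surjective {m : ℕ} (Γ : Set (PP m)) : Function.Surjective (projMap Γ) := by
  unfold projMap
  rw [LinearMap.coe_comp]
  exact (LinearEquiv.surjective _).comp (Submodule.mkQ_surjective _)

theorem projMap_eq_zero_iff {m : ℕ} (Γ : Set (PP m)) (v : Fin m → ℂ) :
    projMap Γ v = 0 ↔ v ∈ linSpan Γ := by
  unfold projMap
  simp

/-- An invariant form descends along the projection. -/
theorem exists_descent {m d : ℕ} {Γ : Set (PP m)} {F : MvPolynomial (Fin m) ℂ}
    (hF : F.IsHomogeneous d) (hinv : F ∈ invariants (linSpan Γ)) :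
    ∃ H : MvPolynomial (Fin (targetDim Γ)) ℂ, H.IsHomogeneous d ∧
      ∀ v, eval (projMap Γ v) H = eval v F := by
  obtain ⟨s, hs⟩ := (projMap Γ).exists_rightInverse_of_surjective
    (LinearMap.range_eq_top.2 (projMap_surjective Γ))
  obtain ⟨H, hH, hHe⟩ := exists_comp_linearMap s hF
  refine ⟨H, hH, fun v => ?_⟩
  have hmem : s (projMap Γ v) - v ∈ linSpan Γ := by
    rw [← projMap_eq_zero_iff, map_sub, ← LinearMap.comp_apply, hs]
    simp
  rw [hHe, ← hinv _ hmem v]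
  simp

theorem eval_rep_eq_zero_of_mem_projImage {m d : ℕ} {Γ X : Set (PP m)}
    {H : MvPolynomial (Fin (targetDim Γ)) ℂ} (hH : H.IsHomogeneous d)
    (h0 : ∀ p ∈ X, eval (projMap Γ p.rep) H = 0) {y : PP (targetDim Γ)}
    (hy : y ∈ projImage Γ X) : eval y.rep H = 0 := by
  have hcl : IsClosed {y : PP (targetDim Γ) | eval y.rep H = 0} :=
    ⟨by simpa [Set.compl_ofPred] using isOpen_eval_ne_zero hH⟩
  refine closure_minimal ?_ hcl hy
  rintro _ ⟨p, hp, h, rfl⟩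
  exact (eval_rep_mk_eq_zero_iff hH _ h).2 (h0 p hp)

theorem mk_projMap_mem_projImage {m : ℕ} {Γ X : Set (PP m)} {p : PP m} (hp : p ∈ X)
    (h : projMap Γ p.rep ≠ 0) : Projectivization.mk ℂ (projMap Γ p.rep) h ∈ projImage Γ X :=
  subset_closure ⟨p, hp, h, rfl⟩

/-- Invariant forms that vanish on `X` vanish on every set with the same projection. -/
theorem eval_eq_zero_of_projImage_eq {m d : ℕ} {Γ X X' : Set (PP m)} (hne : X.Nonempty)
    (hproj : projImage Γ X' = projImage Γ X) {F : MvPolynomial (Fin m) ℂ}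
    (hF : F.IsHomogeneous d) (hinv : F ∈ invariants (linSpan Γ))
    (h0 : ∀ p ∈ X, eval p.rep F = 0) {p : PP m} (hp : p ∈ X') : eval p.rep F = 0 := by
  obtain ⟨H, hH, hHe⟩ := exists_descent hF hinv
  -- On the centre `F` takes the value of `H` at the origin, which is nonzero only for a nonzero
  -- constant; a point of `X` excludes that case.
  by_cases h : projMap Γ p.rep = 0
  · obtain ⟨x, hx⟩ := hne
    have := eval_smul_of_isHomogeneous hH 0 (projMap Γ x.rep)
    rw [zero_smul, hHe, h0 x hx, mul_zero] at this
    rw [← hHe, h, this]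
  · have hy := mk_projMap_mem_projImage hp h
    rw [hproj] at hy
    rw [← hHe, ← eval_rep_mk_eq_zero_iff hH _ h]
    exact eval_rep_eq_zero_of_mem_projImage hH (fun x hx => by rw [hHe, h0 x hx]) hy

/-- The quadrics through a projection are the quadrics that are invariant along its centre. -/
theorem quadrics_projImage_eq_bot_iff {m : ℕ} (Γ X : Set (PP m)) :
    quadrics (projImage Γ X) = ⊥ ↔ quadrics X ⊓ invariants (linSpan Γ) = ⊥ := by
  simp only [Submodule.eq_bot_iff]
  constructor
  · rintro h F ⟨hF, hinv⟩
    obtain ⟨hF0, hF2⟩ := mem_quadrics_iff_rep.1 hF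
    obtain ⟨H, hH, hHe⟩ := exists_descent hF2 hinv
    have hH0 : H = 0 := h H (mem_quadrics_iff_rep.2 ⟨fun y hy =>
      eval_rep_eq_zero_of_mem_projImage hH (fun x hx => by rw [hHe, hF0 x hx]) hy, hH⟩)
    exact MvPolynomial.funext fun v => by rw [← hHe, hH0, map_zero, map_zero]
  · intro h H hH
    obtain ⟨hH0, hH2⟩ := mem_quadrics_iff_rep.1 hH
    obtain ⟨F, hF, hFe⟩ := exists_comp_linearMap (projMap Γ) hH2
    have hF0 : F = 0 := by
      refine h F ⟨mem_quadrics_iff_rep.2 ⟨fun p hp => ?_, hF⟩, fun l hl v => ?_⟩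
      · rw [hFe]
        by_cases hz : projMap Γ p.rep = 0
        · simpa [hz] using eval_smul_of_isHomogeneous hH2 0 0
        · exact (eval_rep_mk_eq_zero_iff hH2 _ hz).1 (hH0 _ (mk_projMap_mem_projImage hp hz))
      · rw [hFe, hFe, map_add, (projMap_eq_zero_iff Γ l).2 hl, add_zero]
    refine MvPolynomial.funext fun y => ?_
    obtain ⟨v, rfl⟩ := projMap_surjective Γ y
    rw [← hFe, hF0, map_zero, map_zero]

/-! ### Polar forms and singular points -/

theorem exists_linearMap_eval_eq {m : ℕ} {F : MvPolynomial (Fin m) ℂ} (hF : F.IsHomogeneous 1) :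
    ∃ ℓ : (Fin m → ℂ) →ₗ[ℂ] ℂ, ∀ v, eval v F = ℓ v := by
  rw [← mem_homogeneousSubmodule, homogeneousSubmodule_one_eq_span_X] at hF
  induction hF using Submodule.span_induction with
  | mem _ h => obtain ⟨i, rfl⟩ := h; exact ⟨LinearMap.proj i, by simp⟩
  | zero => exact ⟨0, by simp⟩
  | add _ _ _ _ h1 h2 =>
    obtain ⟨a, ha⟩ := h1
    obtain ⟨b, hb⟩ := h2
    exact ⟨a + b, by simp [ha, hb]⟩
  | smul c _ _ h =>
    obtain ⟨a, ha⟩ := h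
    exact ⟨c • a, by simp [ha]⟩

theorem exists_quadraticForm_eval_eq {m : ℕ} {F : MvPolynomial (Fin m) ℂ}
    (hF : F.IsHomogeneous 2) : ∃ Q : QuadraticForm ℂ (Fin m → ℂ), ∀ v, eval v F = Q v := by
  rw [← mem_homogeneousSubmodule, ← homogeneousSubmodule_one_pow, pow_two] at hF
  refine Submodule.mul_induction_on hF (fun f hf g hg => ?_) (fun f g h1 h2 => ?_)
  · obtain ⟨a, ha⟩ := exists_linearMap_eval_eq hf
    obtain ⟨b, hb⟩ := exists_linearMap_eval_eq hg
    exact ⟨QuadraticMap.linMulLin a b, by simp [ha, hb]⟩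
  · obtain ⟨a, ha⟩ := h1
    obtain ⟨b, hb⟩ := h2
    exact ⟨a + b, by simp [ha, hb]⟩

/-- The polar form of a polynomial function. -/
noncomputable def polar {m : ℕ} (F : MvPolynomial (Fin m) ℂ) (v w : Fin m → ℂ) : ℂ :=
  QuadraticMap.polar (fun x => eval x F) v w

theorem polar_eq {m : ℕ} (F : MvPolynomial (Fin m) ℂ) (v w : Fin m → ℂ) :
    polar F v w = eval (v + w) F - eval v F - eval w F := rfl

theorem polar_comm {m : ℕ} (F : MvPolynomial (Fin m) ℂ) (v w : Fin m → ℂ) :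
    polar F v w = polar F w v := QuadraticMap.polar_comm _ v w

theorem exists_bilin_polar_eq {m : ℕ} {F : MvPolynomial (Fin m) ℂ} (hF : F.IsHomogeneous 2) :
    ∃ B : LinearMap.BilinMap ℂ (Fin m → ℂ) ℂ, ∀ v w, polar F v w = B v w := by
  obtain ⟨Q, hQ⟩ := exists_quadraticForm_eval_eq hF
  refine ⟨Q.polarBilin, fun v w => ?_⟩
  simp [polar, hQ]

/-- Since 2 is invertible, a vanishing polar at `p` already forces `F` to vanish at `p`, so
invariance along `p` means being singular there. -/
theorem mem_invariants_iff_polar {m : ℕ} {F : MvPolynomial (Fin m) ℂ} (hF : F.IsHomogeneous 2)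
    (p : PP m) : F ∈ invariants p.submodule ↔ ∀ v, polar F p.rep v = 0 := by
  obtain ⟨B, hB⟩ := exists_bilin_polar_eq hF
  rw [Projectivization.submodule_eq, mem_invariants]
  have hdouble : polar F p.rep p.rep = 2 * eval p.rep F := by
    rw [polar_eq, ← two_smul ℂ p.rep, eval_smul_of_isHomogeneous hF]
    ring
  constructor
  · intro h v
    have h1 := h p.rep (Submodule.mem_span_singleton_self _)
    have h2 := h1 0
    have h3 : eval (0 : Fin m → ℂ) F = 0 := by simpa using eval_smul_of_isHomogeneous hF 0 0
    rw [zero_add] at h2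
    rw [polar_comm, polar_eq, h1 v, h2, h3]
    ring
  · intro h l hl v
    obtain ⟨c, rfl⟩ := Submodule.mem_span_singleton.1 hl
    have h1 : eval p.rep F = 0 := by simpa [h] using hdouble
    have h2 : polar F v (c • p.rep) = 0 := by rw [hB, map_smul, ← hB, polar_comm, h, smul_zero]
    rw [polar_eq, eval_smul_of_isHomogeneous hF, h1] at h2
    linear_combination h2

/-! ### Quadrics of a cone and the determinant form -/

/-- A cone is a union of lines through its vertex. -/
theorem mk_add_mem_of_isConeWithVertex {m : ℕ} {X' : Set (PP m)} {q : PP m}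
    (hcone : IsConeWithVertex X' q) {p : PP m} (hp : p ∈ X') (h : p.rep + q.rep ≠ 0) :
    Projectivization.mk ℂ (p.rep + q.rep) h ∈ X' := by
  obtain ⟨-, Y, -, -, -, hX'⟩ := hcone
  rw [hX', Set.mem_iUnion₂] at hp ⊢
  obtain ⟨y, hy, hpy⟩ := hp
  refine ⟨y, hy, ?_⟩
  have hpy' : p.submodule ≤ linSpan {q, y} := hpy
  have hq : q.submodule ≤ linSpan {q, y} := le_iSup₂_of_le q (by simp) le_rfl
  change (Projectivization.mk ℂ (p.rep + q.rep) h).submodule ≤ linSpan {q, y}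
  rw [Projectivization.submodule_mk, Submodule.span_singleton_le_iff_mem]
  refine add_mem (hpy' ?_) (hq ?_) <;>
    · rw [Projectivization.submodule_eq]
      exact Submodule.mem_span_singleton_self _

/-- The quadrics through a non-degenerate cone are singular at the vertex. -/
theorem quadrics_le_invariants_of_isConeWithVertex {m : ℕ} {X' : Set (PP m)} {q : PP m}
    (hcone : IsConeWithVertex X' q) (hnd : NonDegenerate X') :
    quadrics X' ≤ invariants q.submodule := by
  intro F hF
  have hF' := mem_quadrics.1 hF
  rw [mem_invariants_iff_polar hF'.2]
  obtain ⟨B, hB⟩ := exists_bilin_polar_eq hF'.2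
  -- The polar at `q` is linear, so by non-degeneracy it is enough that it vanishes on `X'`; there
  -- `F` vanishes at `p`, `q` and `p + q`.
  have hz : B q.rep = 0 := by
    by_contra hne
    obtain ⟨p, hp, hpne⟩ := hnd _ hne
    apply hpne
    have h0 := (mem_quadrics_iff_rep.1 hF).1
    rw [← hB, polar_comm, polar_eq, h0 p hp, h0 q hcone.1]
    by_cases h : p.rep + q.rep = 0
    · simpa [h] using eval_smul_of_isHomogeneous hF'.2 0 0
    · simpa using hF'.1 _ h (mk_add_mem_of_isConeWithVertex hcone hp h)
  intro v
  rw [hB, hz, LinearMap.zero_apply]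

/-- For a linear family `D` of quadrics without members singular at `a`, the quadrics of `D` have no
member singular at `v` unless a certain form vanishes at `v`. -/
theorem exists_form_of_inf_invariants_eq_bot {m : ℕ} {D : Submodule ℂ (MvPolynomial (Fin m) ℂ)}
    [Module.Finite ℂ D] (hD : ∀ F ∈ D, F.IsHomogeneous 2) {q : PP m}
    (hq : D ≤ invariants q.submodule) {a : PP m} (ha : D ⊓ invariants a.submodule = ⊥) :
    ∃ (d : ℕ) (G : MvPolynomial (Fin m) ℂ), G.IsHomogeneous d ∧ G ∈ invariants q.submodule ∧
      eval a.rep G ≠ 0 ∧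
      ∀ p : PP m, eval p.rep G ≠ 0 → D ⊓ invariants p.submodule = ⊥ := by
  let φ : (Fin m → ℂ) →ₗ[ℂ] D →ₗ[ℂ] ((Fin m → ℂ) → ℂ) :=
    LinearMap.mk₂ ℂ (fun v F w => polar F.1 v w)
      (fun v v' F => by
        obtain ⟨B, hB⟩ := exists_bilin_polar_eq (hD F.1 F.2)
        funext w
        simp [hB])
      (fun c v F => by
        obtain ⟨B, hB⟩ := exists_bilin_polar_eq (hD F.1 F.2)
        funext w
        simp [hB])
      (fun v F F' => by
        funext w
        simp only [polar_eq, Submodule.coe_add, map_add, Pi.add_apply]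
        ring)
      (fun c v F => by
        funext w
        simp only [polar_eq, Submodule.coe_smul, smul_eval, Pi.smul_apply, smul_eq_mul]
        ring)
  have hφ : ∀ v F w, φ v F w = polar F.1 v w := fun _ _ _ => rfl
  have hφker : ∀ (p : PP m) (F : D), φ p.rep F = 0 ↔ F.1 ∈ invariants p.submodule := by
    intro p F
    rw [mem_invariants_iff_polar (hD F.1 F.2)]
    exact ⟨fun h v => by rw [← hφ, h]; rfl, fun h => funext fun v => by rw [hφ, h]; rfl⟩
  have hinj : LinearMap.ker (φ a.rep) = ⊥ := by
    rw [LinearMap.ker_eq_bot']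
    intro F hF
    have : F.1 ∈ D ⊓ invariants a.submodule := ⟨F.2, (hφker a F).1 hF⟩
    rw [ha, Submodule.mem_bot] at this
    exact Subtype.ext this
  obtain ⟨T, hT⟩ := (φ a.rep).exists_leftInverse_of_injective hinj
  let Ψ : (Fin m → ℂ) →ₗ[ℂ] Module.End ℂ D := φ.compr₂ T
  have hΨ : ∀ v F, Ψ v F = T (φ v F) := fun _ _ => rfl
  -- Up to sign `G` is the determinant of `Ψ v`. Since `Ψ` at `a` is the identity, `G` is nonzero
  -- there, and wherever `G` is nonzero `φ v` is injective.
  let G := (LinearMap.polyCharpoly Ψ (Pi.basisFun ℂ (Fin m))).coeff 0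
  have hG : ∀ v, eval v G = (Ψ v).charpoly.coeff 0 := by
    intro v
    have := LinearMap.polyCharpoly_coeff_eval Ψ (Pi.basisFun ℂ (Fin m)) v 0
    rw [← this]
    congr 2
  have hGne : ∀ v, eval v G ≠ 0 ↔ LinearMap.ker (Ψ v) = ⊥ := by
    intro v
    rw [hG, ← not_iff_not, not_not, ← ne_eq, ← LinearMap.det_eq_zero_iff_ker_ne_bot,
      LinearMap.det_eq_sign_charpoly_coeff]
    simp
  refine ⟨Module.finrank ℂ D, G, ?_, ?_, ?_, ?_⟩
  · exact LinearMap.polyCharpoly_coeff_isHomogeneous Ψ _ 0 _ (by simp)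
  · intro l hl v
    have hl0 : φ l = 0 := by
      rw [Projectivization.submodule_eq] at hl
      obtain ⟨c, rfl⟩ := Submodule.mem_span_singleton.1 hl
      have : φ q.rep = 0 := LinearMap.ext fun F => (hφker q F).2 (hq F.2)
      rw [map_smul, this, smul_zero]
    have : Ψ (v + l) = Ψ v := LinearMap.ext fun F => by
      rw [hΨ, hΨ, map_add, hl0, add_zero]
    rw [hG, hG, this]
  · rw [hGne, LinearMap.ker_eq_bot']
    intro F hF
    rw [hΨ, ← LinearMap.comp_apply, hT] at hF
    exact hF
  · intro p hp
    rw [hGne, LinearMap.ker_eq_bot'] at hp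
    rw [Submodule.eq_bot_iff]
    rintro F ⟨hFD, hF⟩
    have : φ p.rep ⟨F, hFD⟩ = 0 := (hφker p _).2 hF
    simpa using congrArg Subtype.val (hp ⟨F, hFD⟩ (by rw [hΨ, this, map_zero]))

theorem linSpan_insert {m : ℕ} (p : PP m) (Γ : Set (PP m)) :
    linSpan (insert p Γ) = p.submodule ⊔ linSpan Γ := iSup_insert

theorem linSpan_singleton {m : ℕ} (p : PP m) : linSpan {p} = p.submodule := iSup_singleton

theorem linSpan_mono {m : ℕ} {Γ Δ : Set (PP m)} (h : Γ ⊆ Δ) : linSpan Γ ≤ linSpan Δ :=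
  biSup_mono h

/-! ### Dropping the residual and exchanging points -/

/-- A quadric of `X` that does not contain `X'` is not singular at the vertex, so its polar at the
vertex does not vanish at some point of `X`. -/
theorem exists_polar_ne_zero {m : ℕ} {X X' : Set (PP m)} {q : PP m} (hne : X.Nonempty)
    (hXnd : NonDegenerate X) (hproj : projImage {q} X' = projImage {q} X)
    {F : MvPolynomial (Fin m) ℂ} (hF : F ∈ quadrics X) (hF' : F ∉ quadrics X') :
    ∃ p ∈ X, polar F q.rep p.rep ≠ 0 := by
  have hF2 := mem_quadrics_iff_rep.1 hF
  obtain ⟨B, hB⟩ := exists_bilin_polar_eq hF2.2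
  have hBne : B q.rep ≠ 0 := by
    intro h0
    have hinv : F ∈ invariants (linSpan {q}) := by
      rw [linSpan_singleton, mem_invariants_iff_polar hF2.2]
      intro v
      rw [hB, h0, LinearMap.zero_apply]
    exact hF' (mem_quadrics_iff_rep.2 ⟨fun p hp =>
      eval_eq_zero_of_projImage_eq hne hproj hF2.2 hinv hF2.1 hp, hF2.2⟩)
  obtain ⟨p, hp, h⟩ := hXnd _ hBne
  exact ⟨p, hp, by rwa [hB]⟩

/-- Projecting from a point off the polar of the vertex makes the residual drop. -/
theorem finrank_add_lt_of_polar_ne_zero {m : ℕ} {X X' : Set (PP m)} {p q : PP m} (hXX' : X ⊆ X')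
    (hq : quadrics X' ≤ invariants q.submodule) (L : Submodule ℂ (Fin m → ℂ))
    {F : MvPolynomial (Fin m) ℂ} (hF : F ∈ quadrics X ⊓ invariants L)
    (hpol : polar F q.rep p.rep ≠ 0) :
    Module.finrank ℂ ↥(quadrics X ⊓ invariants (L ⊔ p.submodule)) +
        Module.finrank ℂ ↥(quadrics X' ⊓ invariants L) <
      Module.finrank ℂ ↥(quadrics X ⊓ invariants L) +
        Module.finrank ℂ ↥(quadrics X' ⊓ invariants (L ⊔ p.submodule)) := by
  have := finite_quadrics X
  have := finite_quadrics X'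
  set A := quadrics X ⊓ invariants L
  set A₂ := quadrics X ⊓ invariants (L ⊔ p.submodule)
  set B := quadrics X' ⊓ invariants L
  set B₂ := quadrics X' ⊓ invariants (L ⊔ p.submodule)
  have hA : A₂ ≤ A := inf_le_inf_left _ (invariants_anti le_sup_left)
  have hBA : B ≤ A := inf_le_inf_right _ (quadrics_anti hXX')
  have hinf : A₂ ⊓ B = B₂ := by
    apply le_antisymm
    · rintro G ⟨⟨-, h1⟩, h2, -⟩
      exact ⟨h2, h1⟩
    · rintro G ⟨h1, h2⟩
      exact ⟨⟨quadrics_anti hXX' h1, h2⟩, h1, invariants_anti le_sup_left h2⟩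
  -- Members of `A₂` are singular at `p` and those of `B` at `q`, so the polar pairing of `q` with
  -- `p` vanishes on the sum, but not on `F`.
  have hlt : A₂ ⊔ B < A := by
    refine lt_of_le_of_ne (sup_le hA hBA) fun h => hpol ?_
    rw [← h] at hF
    obtain ⟨G, hG, G', hG', rfl⟩ := Submodule.mem_sup.1 hF
    have h1 : polar G q.rep p.rep = 0 := by
      rw [polar_comm]
      exact (mem_invariants_iff_polar (mem_quadrics.1 hG.1).2 p).1
        (invariants_anti le_sup_right hG.2) _
    have h2 : polar G' q.rep p.rep = 0 :=
      (mem_invariants_iff_polar (mem_quadrics.1 hG'.1).2 q).1 (hq hG'.1) _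
    rw [polar_eq] at h1 h2 ⊢
    simp only [map_add]
    linear_combination h1 + h2
  have hsum := Submodule.finrank_sup_add_finrank_inf_eq A₂ B
  rw [hinf] at hsum
  have := Submodule.finrank_lt_finrank_of_lt hlt
  omega

/-- One replacement step: a point `a` of the cone can be replaced by a point `p` of `X` which in
addition decreases the residual. -/
theorem exists_point_finrank_le {m k : ℕ} {X X' : Set (PP m)} {q : PP m} (hXirr : IsIrreducible X)
    (hXnd : NonDegenerate X) (hXX' : X ⊆ X') (hq : quadrics X' ≤ invariants q.submodule)
    (hproj : projImage {q} X' = projImage {q} X) {L W : Submodule ℂ (Fin m → ℂ)} {a : PP m}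
    (ha : a ∈ X') (hW : quadrics X' ⊓ invariants (W ⊔ a.submodule) = ⊥)
    (hL : Module.finrank ℂ ↥(quadrics X ⊓ invariants L) ≤
      Module.finrank ℂ ↥(quadrics X' ⊓ invariants L) + (k + 1)) :
    ∃ p ∈ X, quadrics X' ⊓ invariants (W ⊔ p.submodule) = ⊥ ∧
      Module.finrank ℂ ↥(quadrics X ⊓ invariants (L ⊔ p.submodule)) ≤
        Module.finrank ℂ ↥(quadrics X' ⊓ invariants (L ⊔ p.submodule)) + k := by
  have := finite_quadrics X
  have := finite_quadrics X'
  obtain ⟨d, G, hGd, hGq, hGa, hG⟩ := exists_form_of_inf_invariants_eq_bot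
    (D := quadrics X' ⊓ invariants W) (fun F hF => (mem_quadrics.1 hF.1).2)
    (inf_le_left.trans hq) (a := a) (by rw [inf_assoc, ← invariants_sup, hW])
  have hGX : ∃ p ∈ X, eval p.rep G ≠ 0 := by
    by_contra! h
    exact hGa (eval_eq_zero_of_projImage_eq hXirr.nonempty hproj hGd
      (by rwa [linSpan_singleton]) h ha)
  have hconv : ∀ p : PP m, eval p.rep G ≠ 0 →
      quadrics X' ⊓ invariants (W ⊔ p.submodule) = ⊥ := fun p hp => by
    rw [invariants_sup, ← inf_assoc, hG p hp]
  -- In the first case the residual is already zero and stays so; only the determinant condition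
  -- matters.
  by_cases hAB : quadrics X ⊓ invariants L ≤ quadrics X'
  · obtain ⟨p, hp, hpG⟩ := hGX
    refine ⟨p, hp, hconv p hpG, le_trans (Submodule.finrank_mono ?_) (Nat.le_add_right _ _)⟩
    exact le_inf ((inf_le_inf_left _ (invariants_anti le_sup_left)).trans hAB) inf_le_right
  · obtain ⟨F, hF, hF'⟩ := SetLike.not_le_iff_exists.1 hAB
    obtain ⟨x, hx, hxF⟩ := exists_polar_ne_zero hXirr.nonempty hXnd hproj hF.1 hF'
    obtain ⟨B, hB⟩ := exists_bilin_polar_eq (mem_quadrics.1 hF.1).2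
    obtain ⟨ℓ, hℓ, hℓe⟩ : ∃ ℓ : MvPolynomial (Fin m) ℂ, ℓ.IsHomogeneous 1 ∧
        ∀ v, eval v ℓ = polar F q.rep v := by
      refine ⟨(B q.rep).toMvPolynomial (Pi.basisFun ℂ (Fin m)) (Module.Basis.singleton Unit ℂ) (),
        LinearMap.toMvPolynomial_isHomogeneous _ _ _ _, fun v => ?_⟩
      have := LinearMap.toMvPolynomial_eval_eq_apply (Pi.basisFun ℂ (Fin m))
        (Module.Basis.singleton Unit ℂ) (B q.rep) () ((Pi.basisFun ℂ (Fin m)).repr v)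
      rw [LinearEquiv.symm_apply_apply, Module.Basis.singleton_repr] at this
      rw [hB, ← this]
      congr 2
    obtain ⟨y, hy, hyG⟩ := hGX
    obtain ⟨p, hp, hpG, hpℓ⟩ := hXirr.2 _ _ (isOpen_eval_ne_zero hGd) (isOpen_eval_ne_zero hℓ)
      ⟨y, hy, hyG⟩ ⟨x, hx, by simpa [hℓe] using hxF⟩
    refine ⟨p, hp, hconv p hpG, ?_⟩
    have := finrank_add_lt_of_polar_ne_zero hXX' hq L hF (p := p) (by simpa [hℓe] using hpℓ)
    omega

/-- Induction on the points still to be exchanged, with `L` the span of those already chosen. Chosen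
points may repeat, so the cardinality is only bounded. -/
theorem exists_finset_inf_invariants_eq_bot {m : ℕ} {X X' : Set (PP m)} {q : PP m}
    (hXirr : IsIrreducible X) (hXnd : NonDegenerate X) (hXX' : X ⊆ X')
    (hq : quadrics X' ≤ invariants q.submodule) (hproj : projImage {q} X' = projImage {q} X)
    (l : List (PP m)) (hl : ∀ a ∈ l, a ∈ X') (L : Submodule ℂ (Fin m → ℂ))
    (hl0 : quadrics X' ⊓ invariants (L ⊔ linSpan {a | a ∈ l}) = ⊥)
    (hL : Module.finrank ℂ ↥(quadrics X ⊓ invariants L) ≤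
      Module.finrank ℂ ↥(quadrics X' ⊓ invariants L) + l.length) :
    ∃ Γ : Finset (PP m), (Γ : Set (PP m)) ⊆ X ∧ Γ.card ≤ l.length ∧
      quadrics X ⊓ invariants (L ⊔ linSpan (Γ : Set (PP m))) = ⊥ := by
  classical
  induction l generalizing L with
  | nil =>
    have := finite_quadrics X
    have hB : quadrics X' ⊓ invariants L = ⊥ := by
      simpa [linSpan] using hl0
    refine ⟨∅, by simp, by simp, ?_⟩
    rw [hB] at hL
    simpa [linSpan, Submodule.finrank_eq_zero] using hL
  | cons a l ih =>
    have hset : {b | b ∈ a :: l} = insert a {b | b ∈ l} := by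
      ext b
      simp
    rw [hset, linSpan_insert, sup_comm a.submodule, ← sup_assoc] at hl0
    obtain ⟨p, hp, hp0, hpL⟩ := exists_point_finrank_le hXirr hXnd hXX' hq hproj
      (hl a (by simp)) hl0 hL
    obtain ⟨Γ, hΓX, hΓc, hΓ⟩ := ih (fun b hb => hl b (by simp [hb])) (L ⊔ p.submodule)
      (by rwa [sup_right_comm]) hpL
    refine ⟨insert p Γ, ?_, ?_, ?_⟩
    · rw [Finset.coe_insert]
      exact Set.insert_subset hp hΓX
    · exact (Finset.card_insert_le p Γ).trans (by simpa using hΓc)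
    · rwa [Finset.coe_insert, linSpan_insert, ← sup_assoc]

/-! ### Attaining the quadratic persistence -/

/-- The points of a non-degenerate set span. -/
theorem NonDegenerate.linSpan_eq_top {m : ℕ} {X : Set (PP m)} (h : NonDegenerate X) :
    linSpan X = ⊤ := by
  by_contra hne
  obtain ⟨f, hf0, hf⟩ := Submodule.exists_le_ker_of_lt_top _ (lt_top_iff_ne_top.2 hne)
  obtain ⟨p, hp, hpf⟩ := h f hf0
  refine hpf (hf ((le_iSup₂_of_le p hp le_rfl : p.submodule ≤ linSpan X) ?_))
  rw [Projectivization.submodule_eq]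
  exact Submodule.mem_span_singleton_self _

/-- Finitely many points of a non-degenerate set span. -/
theorem NonDegenerate.exists_finset_linSpan_eq_top {m : ℕ} {X : Set (PP m)}
    (h : NonDegenerate X) : ∃ Γ : Finset (PP m), (Γ : Set (PP m)) ⊆ X ∧
      linSpan (Γ : Set (PP m)) = ⊤ := by
  classical
  have hc : IsCompactElement (⊤ : Submodule ℂ (Fin m → ℂ)) :=
    (Submodule.fg_iff_compact _).1 Module.Finite.fg_top
  have htop := h.linSpan_eq_top
  unfold linSpan at htop
  rw [iSup_subtype'] at htop
  obtain ⟨s, hs⟩ := CompleteLattice.IsCompactElement.exists_finset_of_le_iSup _ hc _ htop.ge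
  refine ⟨s.image Subtype.val, by simp, top_le_iff.1 (hs.trans ?_)⟩
  refine iSup₂_le fun x hx => ?_
  exact le_iSup₂_of_le x.1 (by simpa using hx) le_rfl

/-- The quadratic persistence of a non-degenerate set is attained. -/
theorem NonDegenerate.exists_finset_card_eq_qp {m : ℕ} {X : Set (PP m)} (h : NonDegenerate X) :
    ∃ Γ : Finset (PP m), (Γ : Set (PP m)) ⊆ X ∧ Γ.card = qp X ∧
      quadrics (projImage (Γ : Set (PP m)) X) = ⊥ := by
  refine Nat.sInf_mem (s := {k | ∃ Γ : Finset (PP m), (Γ : Set (PP m)) ⊆ X ∧ Γ.card = k ∧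
    quadrics (projImage (Γ : Set (PP m)) X) = ⊥}) ?_
  obtain ⟨Γ, hΓX, hΓ⟩ := h.exists_finset_linSpan_eq_top
  refine ⟨Γ.card, Γ, hΓX, rfl, ?_⟩
  rw [quadrics_projImage_eq_bot_iff, hΓ, Submodule.eq_bot_iff]
  rintro F ⟨hF, hinv⟩
  have h0 : eval (0 : Fin m → ℂ) F = 0 := by
    simpa using eval_smul_of_isHomogeneous (mem_quadrics.1 hF).2 0 0
  refine MvPolynomial.funext fun v => ?_
  rw [map_zero, ← h0, ← hinv v trivial 0, zero_add]

theorem NonDegenerate.mono {m : ℕ} {X X' : Set (PP m)} (h : NonDegenerate X) (hXX' : X ⊆ X') :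
    NonDegenerate X' := fun ℓ hℓ =>
  let ⟨p, hp, hne⟩ := h ℓ hℓ
  ⟨p, hXX' hp, hne⟩

end QuadPers

theorem theorem4 (n : ℕ) (X X' : Set (QuadPers.PP (n + 1))) (q : QuadPers.PP (n + 1))
    (hX : IsClosed X) (hXirr : IsIrreducible X) (hXnd : QuadPers.NonDegenerate X)
    (hX' : IsClosed X') (hXX' : X ⊆ X')
    (hcone : QuadPers.IsConeWithVertex X' q)
    (hdim : QuadPers.dim X' = 1 + QuadPers.dim X)
    (hproj : QuadPers.projImage {q} X' = QuadPers.projImage {q} X)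
    (htrans : QuadPers.TransverseToGeneralInnerProjections X X') :
    (QuadPers.qp X : ℤ) ≤ max (QuadPers.qp X' : ℤ) (QuadPers.qr X X') := by
  open QuadPers in
  classical
  have hnd' := hXnd.mono hXX'
  have hq := quadrics_le_invariants_of_isConeWithVertex hcone hnd'
  obtain ⟨Γ', hΓ'X, hΓ'c, hΓ'⟩ := hnd'.exists_finset_card_eq_qp
  rw [quadrics_projImage_eq_bot_iff] at hΓ'
  set r := (qr X X').toNat
  -- Padding with copies of `q` makes the list long enough to absorb the residual; it only enlarges
  -- the span.
  let l : List (PP (n + 1)) := Γ'.toList ++ List.replicate (r - qp X') q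
  have hlen : l.length = max (qp X') r := by
    simp only [l, List.length_append, Finset.length_toList, hΓ'c, List.length_replicate]
    omega
  have hbot : invariants (⊥ : Submodule ℂ (Fin (n + 1) → ℂ)) = ⊤ :=
    top_le_iff.1 fun F _ v hv w => by simp [(Submodule.mem_bot ℂ).1 hv]
  have hl : ∀ a ∈ l, a ∈ X' := by
    intro a ha
    rcases List.mem_append.1 ha with h | h
    · exact hΓ'X (by simpa using h)
    · exact (List.eq_of_mem_replicate h) ▸ hcone.1
  have hl0 : quadrics X' ⊓ invariants (⊥ ⊔ linSpan {a | a ∈ l}) = ⊥ := by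
    rw [bot_sup_eq, ← le_bot_iff, ← hΓ']
    exact inf_le_inf_left _ (invariants_anti (linSpan_mono fun a ha =>
      List.mem_append_left _ (by simpa using ha)))
  have hr : qr X X' ≤ r := Int.self_le_toNat _
  obtain ⟨Γ, hΓX, hΓc, hΓ⟩ := exists_finset_inf_invariants_eq_bot hXirr hXnd hXX' hq hproj l hl ⊥
    hl0 (by
      rw [hbot, inf_top_eq, inf_top_eq, hlen]
      unfold qr at hr
      omega)
  rw [bot_sup_eq, ← quadrics_projImage_eq_bot_iff] at hΓ
  have hqp : qp X ≤ max (qp X') r := le_trans (Nat.sInf_le ⟨Γ, hΓX, rfl, hΓ⟩) (hΓc.trans hlen.le)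
  have hr0 : 0 ≤ qr X X' := by
    have := finite_quadrics X
    have := Submodule.finrank_mono (quadrics_anti hXX')
    unfold qr
    omega
  have hrr : (r : ℤ) = qr X X' := Int.toNat_of_nonneg hr0
  rw [← hrr]
  exact_mod_cast hqp
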